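/- For $n\ge 1$ let $M_n$ be the algebra of complex $n\times n$ matrices, with operator norm $\|\cdot\|_\infty$, usual trace $\mathrm{Tr}$ and norms $\|a\|_p=(\mathrm{Tr}\,|a|^p)^{1/p}$, $1\le p<\infty$, where $|a|=(a^*a)^{1/2}$. For $1\le k\le n$ let $\widetilde E_k:M_n\to M_n$ be the faithful conditional expectation that keeps the upper left $k\times k$ corner of a matrix and its diagonal entries, and annihilates all other entries. A martingale is a sequence $x=(x_k)_{k=1}^n$ in $M_n$ with $x_k=\widetilde E_k(x_{k+1})$ for $1\le k<n$; put $dx_k=x_k-x_{k-1}$, with $x_0=0$. Let ${\cal H}^1$ and ${\cal H}^1_{\max}$ be the space of these martingales equipped with the norms $$\|x\|_{{\cal H}^1}=\inf_{x=y+z}\Big\{\Big\|\Big(\sum_{k=1}^n|dy_k|^2\Big)^{1/2}\Big\|_1+\Big\|\Big(\sum_{k=1}^n|dz_k^*|^2\Big)^{1/2}\Big\|_1\Big\},$$ where $y,z$ run over the martingales with $x=y+z$, and $$\|x\|_{{\cal H}^1_{\max}}=\inf\Big\{\|a\|_2\,\sup_{1\le k\le n}\|y_k\|_\infty\,\|b\|_2\Big\},$$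 where the infimum runs over all $a,b\in M_n$ and all $y_1,\dots,y_n\in M_n$ with $x_k=a\,y_k\,b$ for every $k$. Then there is an absolute constant $c>0$ such that for every $n\ge1$ $$\|\mathrm{Id}:{\cal H}^1\to{\cal H}^1_{\max}\|\ \ge\ c\,\log n .$$ -/

import Mathlib

open scoped Matrix MatrixOrder ComplexOrder ENNReal

namespace MatrixHardy

/-- The algebra `M_n` of complex `n × n` matrices. -/
abbrev Mat (n : ℕ) : Type := Matrix (Fin n) (Fin n) ℂ

/-- The operator norm of a matrix acting on `ℓ₂ⁿ`, that is, the norm of `L^∞(M_n)`. -/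
noncomputable def opNorm {n : ℕ} (a : Mat n) : ℝ :=
  ‖Matrix.toEuclideanCLM (n := Fin n) (𝕜 := ℂ) a‖

/-- The `L^p` norm `(Tr |a|^p)^{1/p}` of `M_n` with respect to the usual trace (the Schatten
`p`-norm), where `|a| = (a^* a)^{1/2}`; for `0 < p < ∞`. -/
noncomputable def lpNorm {n : ℕ} (p : ℝ) (a : Mat n) : ℝ :=
  ((Matrix.trace (CFC.abs a ^ p)).re) ^ (1 / p)

/-- `E_k`: keep the upper left corner of a matrix, annihilate all other entries.  Indices start
at `0`, so `k : Fin n` gives the corner of size `k + 1`. -/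
def corner {n : ℕ} (k : Fin n) (a : Mat n) : Mat n :=
  Matrix.of fun i j => if i ≤ k ∧ j ≤ k then a i j else 0

/-- The faithful conditional expectation `Ẽ_k`: the corner `E_k a` together with the diagonal
entries of `a` beyond the corner. -/
def condExp {n : ℕ} (k : Fin n) (a : Mat n) : Mat n :=
  corner k a + Matrix.diagonal fun i => if k < i then a i i else 0

/-- Martingales with respect to the finite filtration `Ẽ_1, …, Ẽ_n` of `M_n`. -/
def IsMartingale {n : ℕ} (x : Fin n → Mat n) : Prop :=
  ∀ j k : Fin n, (k : ℕ) = (j : ℕ) + 1 → x j = condExp j (x k)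

/-- The difference sequence `dx_k = x_k - x_{k-1}`, where the term before the first one is `0`. -/
def diff {n : ℕ} (x : Fin n → Mat n) (k : Fin n) : Mat n :=
  x k - if (k : ℕ) = 0 then 0 else x ⟨(k : ℕ) - 1, lt_of_le_of_lt (Nat.sub_le _ _) k.isLt⟩

/-- `‖(∑_k |dx_k|²)^{1/2}‖₁`. -/
noncomputable def colSquareNorm {n : ℕ} (x : Fin n → Mat n) : ℝ :=
  lpNorm 1 (CFC.sqrt (∑ k, (diff x k)ᴴ * diff x k))

/-- `‖(∑_k |dx_k^*|²)^{1/2}‖₁`. -/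
noncomputable def rowSquareNorm {n : ℕ} (x : Fin n → Mat n) : ℝ :=
  lpNorm 1 (CFC.sqrt (∑ k, diff x k * (diff x k)ᴴ))

/-- The norm of `H^1`: the infimum runs over all decompositions `x = y + z` into martingales. -/
noncomputable def hardyNorm {n : ℕ} (x : Fin n → Mat n) : ℝ≥0∞ :=
  ⨅ (y : Fin n → Mat n) (z : Fin n → Mat n) (_ : IsMartingale y) (_ : IsMartingale z)
    (_ : x = y + z), ENNReal.ofReal (colSquareNorm y + rowSquareNorm z)

/-- The norm of `H^1_max`: the infimum runs over all factorizations `x_k = a y_k b`. -/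
noncomputable def hardyMaxNorm {n : ℕ} (x : Fin n → Mat n) : ℝ≥0∞ :=
  ⨅ (a : Mat n) (b : Mat n) (y : Fin n → Mat n) (_ : ∀ k, x k = a * y k * b),
    ENNReal.ofReal (lpNorm 2 a) * (⨆ k, ENNReal.ofReal (opNorm (y k))) *
      ENNReal.ofReal (lpNorm 2 b)

/-- The norm of the identity map `H^1 → H^1_max`, both spaces consisting of the martingales with
respect to `Ẽ_1, …, Ẽ_n`. -/
noncomputable def idNorm (n : ℕ) : ℝ≥0∞ :=
  ⨆ (x : Fin n → Mat n) (_ : IsMartingale x) (_ : hardyNorm x ≤ 1), hardyMaxNorm x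

end MatrixHardy

/-!
A martingale of rank one realizes the lower bound. With `m = ⌊n / 2⌋`, let `X` be the matrix whose
lower left `m × m` block has all entries `1 / m` and which vanishes elsewhere, and `x_k = Ẽ_k X`.

Since `X` is strictly lower triangular, the only nonzero row of `dx_k` is the `k`-th row of `X`, so
`∑ |dx_k|² = X^* X` and the column square function of `x` is `|X|`. Hence
`‖x‖_{H¹} ≤ ‖X‖₁ = 1` (`hardyNorm_condExp_le`, `lpNorm_one_cornerBlock`).

The norm of `H¹_max` is bounded below by duality (`le_hardyMaxNorm`): if `(f_k)` and `(e_k)` are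
families of vectors satisfying Bessel's inequality and `x_k = a y_k b`, then
`∑ ⟨f_k, x_k e_k⟩ = ∑ ⟨a^* f_k, y_k b e_k⟩`, which the Cauchy-Schwarz inequality bounds by
`‖a‖₂ sup ‖y_k‖ ‖b‖₂`, because `∑ ‖b e_k‖² ≤ ‖b‖₂²` by Bessel's inequality for the rows of `b`,
and likewise for `a^*`.

Here `e_k` is the standard basis in reversed order, and `f_k` is the `k`-th column of the Hilbert
type matrix with entries `2 / (π (2 (k - s) + 1))`. Up to a unimodular factor these entries are the
inner products in `L²[0, 1]` of the two orthonormal families of exponentials `e^{iπjx}` with `j = 2s`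
and `j = 2k + 1`, so the matrix is a contraction (`hilbert_bessel`). The corner projections cut it
down to its triangular part, all of whose entries are positive. The pairing therefore becomes `1 / m`
times the sum of the entries with `s ≤ k < m`, which are at least `1 / (π (k - s + 1))`; summing
harmonic numbers yields a multiple of `log m`.
-/

namespace MatrixHardy

variable {n : ℕ}

/-! ### Schatten norms of exponent one and two -/

/-- The Schatten `2`-norm is the Hilbert-Schmidt norm. -/
theorem lpNorm_two (a : Mat n) : lpNorm 2 a = √(∑ i, ∑ j, ‖a i j‖ ^ 2) := by
  have h1 : CFC.abs a ^ (2 : ℝ) = aᴴ * a := by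
    rw [show (2 : ℝ) = ((2 : ℕ) : ℝ) by norm_num, CFC.rpow_natCast _ _ (CFC.abs_nonneg a), pow_two,
      CFC.abs_mul_abs, Matrix.star_eq_conjTranspose]
  have h2 : (Matrix.trace (aᴴ * a)).re = ∑ i, ∑ j, ‖a i j‖ ^ 2 := by
    rw [Finset.sum_comm]
    simp [Matrix.trace, Matrix.mul_apply, Complex.sq_norm, Complex.normSq_apply]
  rw [lpNorm, h1, h2, Real.sqrt_eq_rpow]

theorem lpNorm_two_nonneg (a : Mat n) : 0 ≤ lpNorm 2 a := by
  rw [lpNorm_two]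
  positivity

theorem sq_lpNorm_two (a : Mat n) : lpNorm 2 a ^ 2 = ∑ i, ∑ j, ‖a i j‖ ^ 2 := by
  rw [lpNorm_two, Real.sq_sqrt (by positivity)]

theorem lpNorm_one (a : Mat n) : lpNorm 1 a = (Matrix.trace (CFC.abs a)).re := by
  rw [lpNorm, CFC.rpow_one _ (CFC.abs_nonneg a)]
  norm_num

/-! ### Duality for the maximal norm -/

section

local notation "toCLM" => Matrix.toEuclideanCLM (n := Fin n) (𝕜 := ℂ)

/-- A family of vectors satisfying Bessel's inequality behaves like an orthonormal one: Bessel's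
inequality, applied to the conjugated rows of `b`, adds up to the Hilbert-Schmidt norm. -/
theorem sum_sq_norm_apply_le {ι : Type*} [Fintype ι] (b : Mat n)
    (e : ι → EuclideanSpace ℂ (Fin n))
    (he : ∀ w, ∑ i, ‖inner ℂ w (e i)‖ ^ 2 ≤ ‖w‖ ^ 2) :
    ∑ i, ‖toCLM b (e i)‖ ^ 2 ≤ lpNorm 2 b ^ 2 := by
  rw [sq_lpNorm_two]
  simp_rw [EuclideanSpace.norm_sq_eq]
  rw [Finset.sum_comm]
  refine Finset.sum_le_sum fun r _ => ?_
  have h := he (WithLp.toLp 2 (star (b r)))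
  rw [EuclideanSpace.norm_sq_eq] at h
  simp only [Pi.star_apply, norm_star] at h
  refine le_trans (le_of_eq ?_) h
  refine Finset.sum_congr rfl fun i _ => ?_
  congr 2
  simp [Matrix.ofLp_toEuclideanCLM, Matrix.mulVec, dotProduct, PiLp.inner_apply, mul_comm]

/-- The trace duality between factorizable sequences `a * y i * b` and sums of rank-one matrices
coming from two Bessel families. -/
theorem norm_sum_inner_le {ι : Type*} [Fintype ι] (a b : Mat n) (y : ι → Mat n) (S : ℝ)
    (hS : ∀ i, opNorm (y i) ≤ S) (f e : ι → EuclideanSpace ℂ (Fin n))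
    (hf : ∀ w, ∑ i, ‖inner ℂ w (f i)‖ ^ 2 ≤ ‖w‖ ^ 2)
    (he : ∀ w, ∑ i, ‖inner ℂ w (e i)‖ ^ 2 ≤ ‖w‖ ^ 2) (hS0 : 0 ≤ S) :
    ‖∑ i, inner ℂ (f i) (toCLM (a * y i * b) (e i))‖ ≤ lpNorm 2 a * S * lpNorm 2 b := by
  have ha : lpNorm 2 aᴴ ^ 2 = lpNorm 2 a ^ 2 := by
    rw [sq_lpNorm_two, sq_lpNorm_two, Finset.sum_comm]
    simp [Matrix.conjTranspose_apply]
  have key : ∀ i, ‖inner ℂ (f i) (toCLM (a * y i * b) (e i))‖ ≤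
      S * (‖toCLM aᴴ (f i)‖ * ‖toCLM b (e i)‖) := fun i => by
    have h1 : inner ℂ (f i) (toCLM (a * y i * b) (e i)) =
        inner ℂ (toCLM aᴴ (f i)) (toCLM (y i) (toCLM b (e i))) := by
      rw [← Matrix.star_eq_conjTranspose, map_star, ContinuousLinearMap.star_eq_adjoint,
        ContinuousLinearMap.adjoint_inner_left, map_mul, map_mul]
      rfl
    rw [h1]
    calc _ ≤ ‖toCLM aᴴ (f i)‖ * ‖toCLM (y i) (toCLM b (e i))‖ := norm_inner_le_norm _ _
      _ ≤ ‖toCLM aᴴ (f i)‖ * (S * ‖toCLM b (e i)‖) := by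
          gcongr
          exact (ContinuousLinearMap.le_opNorm _ _).trans (by gcongr; exact hS i)
      _ = _ := by ring
  calc _ ≤ ∑ i, ‖inner ℂ (f i) (toCLM (a * y i * b) (e i))‖ := norm_sum_le _ _
    _ ≤ ∑ i, S * (‖toCLM aᴴ (f i)‖ * ‖toCLM b (e i)‖) := Finset.sum_le_sum fun i _ => key i
    _ = S * ∑ i, ‖toCLM aᴴ (f i)‖ * ‖toCLM b (e i)‖ := by rw [Finset.mul_sum]
    _ ≤ S * (√(∑ i, ‖toCLM aᴴ (f i)‖ ^ 2) * √(∑ i, ‖toCLM b (e i)‖ ^ 2)) := by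
        gcongr
        exact Real.sum_mul_le_sqrt_mul_sqrt _ _ _
    _ ≤ S * (√(lpNorm 2 aᴴ ^ 2) * √(lpNorm 2 b ^ 2)) := by
        gcongr <;> exact sum_sq_norm_apply_le _ _ (by assumption)
    _ = _ := by
        rw [ha, Real.sqrt_sq (lpNorm_two_nonneg a), Real.sqrt_sq (lpNorm_two_nonneg b)]
        ring

/-- Pairing with two Bessel families bounds the norm of `H¹_max` from below. -/
theorem le_hardyMaxNorm (x : Fin n → Mat n) (f e : Fin n → EuclideanSpace ℂ (Fin n))
    (hf : ∀ w, ∑ i, ‖inner ℂ w (f i)‖ ^ 2 ≤ ‖w‖ ^ 2)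
    (he : ∀ w, ∑ i, ‖inner ℂ w (e i)‖ ^ 2 ≤ ‖w‖ ^ 2) :
    ENNReal.ofReal ‖∑ k, inner ℂ (f k) (toCLM (x k) (e k))‖ ≤ hardyMaxNorm x := by
  refine le_iInf fun a => le_iInf fun b => le_iInf fun y => le_iInf fun h => ?_
  have hbdd : BddAbove (Set.range fun k => opNorm (y k)) := (Set.finite_range _).bddAbove
  have h0 : 0 ≤ ⨆ k, opNorm (y k) := Real.iSup_nonneg fun k => norm_nonneg _
  have hsup : ENNReal.ofReal (⨆ k, opNorm (y k)) ≤ ⨆ k, ENNReal.ofReal (opNorm (y k)) := by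
    rcases isEmpty_or_nonempty (Fin n) with hn | hn
    · simp
    · obtain ⟨k, hk⟩ := exists_eq_ciSup_of_finite (f := fun k => opNorm (y k))
      rw [← hk]
      exact le_iSup (fun k => ENNReal.ofReal (opNorm (y k))) k
  refine le_trans ?_ (mul_le_mul_left (mul_le_mul_right hsup _) _)
  rw [← ENNReal.ofReal_mul (lpNorm_two_nonneg a),
    ← ENNReal.ofReal_mul (mul_nonneg (lpNorm_two_nonneg a) h0)]
  refine ENNReal.ofReal_le_ofReal ?_
  simp only [h]
  exact norm_sum_inner_le a b y _ (le_ciSup hbdd) f e hf he h0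

end

/-! ### Martingales of strictly lower triangular matrices -/

theorem condExp_condExp {j k : Fin n} (h : j ≤ k) (a : Mat n) :
    condExp j (condExp k a) = condExp j a := by
  ext r s
  simp only [condExp, corner, Matrix.add_apply, Matrix.of_apply, Matrix.diagonal_apply]
  grind

theorem isMartingale_condExp (a : Mat n) : IsMartingale fun k => condExp k a :=
  fun j k h => (condExp_condExp (Fin.le_def.2 (by omega)) a).symm

theorem condExp_apply_of_lower {a : Mat n} (ha : ∀ i j, i ≤ j → a i j = 0) (k i j : Fin n) :
    condExp k a i j = if i ≤ k then a i j else 0 := by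
  have := ha i j
  simp only [condExp, corner, Matrix.add_apply, Matrix.of_apply, Matrix.diagonal_apply]
  grind

theorem diff_condExp_of_lower {a : Mat n} (ha : ∀ i j, i ≤ j → a i j = 0) (k i j : Fin n) :
    diff (fun k => condExp k a) k i j = if i = k then a i j else 0 := by
  rw [diff]
  split_ifs with h0 h1 h1 <;>
    simp only [Matrix.sub_apply, Matrix.zero_apply, condExp_apply_of_lower ha, Fin.le_def] <;>
    grind

theorem sum_diff_condExp_of_lower {a : Mat n} (ha : ∀ i j, i ≤ j → a i j = 0) :
    ∑ k, (diff (fun k => condExp k a) k)ᴴ * diff (fun k => condExp k a) k = aᴴ * a := by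
  ext r s
  simp only [Matrix.sum_apply, Matrix.mul_apply, Matrix.conjTranspose_apply,
    diff_condExp_of_lower ha]
  simp

/-- On strictly lower triangular matrices the norm of `H¹` is dominated by the trace norm: the column
square function of the martingale is the absolute value of the matrix. -/
theorem hardyNorm_condExp_le {a : Mat n} (ha : ∀ i j, i ≤ j → a i j = 0) :
    hardyNorm (fun k => condExp k a) ≤ ENNReal.ofReal (lpNorm 1 a) := by
  have h0 : IsMartingale (0 : Fin n → Mat n) := fun j k _ => by
    ext r s
    simp [condExp, corner]
  have hr : rowSquareNorm (0 : Fin n → Mat n) = 0 := by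
    have hd : ∀ k, diff (0 : Fin n → Mat n) k = 0 := fun k => by simp [diff]
    simp only [rowSquareNorm, hd, zero_mul, Finset.sum_const_zero, CFC.sqrt_zero, lpNorm_one,
      CFC.abs_zero, Matrix.trace_zero, Complex.zero_re]
  have hc : colSquareNorm (fun k => condExp k a) = lpNorm 1 a := by
    rw [colSquareNorm, sum_diff_condExp_of_lower ha, ← Matrix.star_eq_conjTranspose]
    change lpNorm 1 (CFC.abs a) = _
    rw [lpNorm_one, lpNorm_one, CFC.cfcAbs_cfcAbs]
  refine (iInf₂_le_of_le (fun k => condExp k a) 0 (iInf₂_le_of_le (isMartingale_condExp a) h0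
    (iInf_le_of_le (add_zero _).symm ?_)))
  rw [hr, hc, add_zero]

/-! ### The Hilbert matrix -/

/-- The exponential `x ↦ e^{iπkx}` on the unit interval. The exponentials of
even index are orthonormal, and so are those of odd index. -/
noncomputable def expo (k : ℤ) : C(unitInterval, ℂ) :=
  ⟨fun x => Complex.exp (Real.pi * Complex.I * k * (x : ℝ)), by fun_prop⟩

/-- The class of `expo k` in `L²[0, 1]`. -/
noncomputable def expoLp (k : ℤ) :
    MeasureTheory.Lp ℂ 2 (MeasureTheory.volume : MeasureTheory.Measure unitInterval) :=
  ContinuousMap.toLp 2 MeasureTheory.volume ℂ (expo k)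

theorem inner_expoLp_eq_integral (j k : ℤ) :
    inner ℂ (expoLp j) (expoLp k) =
      ∫ x in (0 : ℝ)..1, Complex.exp (Real.pi * Complex.I * ((k - j : ℤ) : ℂ) * x) := by
  rw [expoLp, expoLp, MeasureTheory.ContinuousMap.inner_toLp,
    intervalIntegral.integral_of_le zero_le_one, ← MeasureTheory.integral_Icc_eq_integral_Ioc,
    ← MeasureTheory.integral_subtype measurableSet_Icc
      (fun x : ℝ => Complex.exp (Real.pi * Complex.I * ((k - j : ℤ) : ℂ) * x))]
  refine MeasureTheory.integral_congr_ae (.of_forall fun x => ?_)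
  simp only [expo, ContinuousMap.coe_mk, ← Complex.exp_conj, ← Complex.exp_add]
  congr 1
  simp
  ring

theorem inner_expoLp_of_ne {j k : ℤ} (h : j ≠ k) :
    inner ℂ (expoLp j) (expoLp k) =
      (Complex.exp (Real.pi * Complex.I * ((k - j : ℤ) : ℂ)) - 1) /
        (Real.pi * Complex.I * ((k - j : ℤ) : ℂ)) := by
  have h0 : (Real.pi * Complex.I * ((k - j : ℤ) : ℂ)) ≠ 0 := by
    have : ((k - j : ℤ) : ℂ) ≠ 0 := by exact_mod_cast sub_ne_zero.2 h.symm
    have : (Real.pi : ℂ) ≠ 0 := by exact_mod_cast Real.pi_ne_zero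
    simp_all
  rw [inner_expoLp_eq_integral, integral_exp_mul_complex h0]
  simp

theorem inner_expoLp_self (k : ℤ) : inner ℂ (expoLp k) (expoLp k) = 1 := by
  rw [inner_expoLp_eq_integral]
  simp

theorem inner_expoLp_of_even {j k : ℤ} (h : j ≠ k) (he : Even (k - j)) :
    inner ℂ (expoLp j) (expoLp k) = 0 := by
  obtain ⟨d, hd⟩ := he
  rw [inner_expoLp_of_ne h, hd, show (Real.pi * Complex.I * ((d + d : ℤ) : ℂ)) =
    d * (2 * Real.pi * Complex.I) by push_cast; ring, Complex.exp_int_mul_two_pi_mul_I]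
  simp

theorem inner_expoLp_of_odd {j k : ℤ} (ho : Odd (k - j)) :
    inner ℂ (expoLp j) (expoLp k) = Complex.I * (2 / (Real.pi * (k - j))) := by
  have hne : j ≠ k := by rintro rfl; simp at ho
  have h1 : (k - j : ℂ) ≠ 0 := by exact_mod_cast sub_ne_zero.2 hne.symm
  have h2 : (Real.pi : ℂ) ≠ 0 := by exact_mod_cast Real.pi_ne_zero
  obtain ⟨d, hd⟩ := ho
  rw [inner_expoLp_of_ne hne]
  have : Complex.exp (Real.pi * Complex.I * ((k - j : ℤ) : ℂ)) = -1 := by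
    rw [hd, show (Real.pi * Complex.I * ((2 * d + 1 : ℤ) : ℂ)) =
      d * (2 * Real.pi * Complex.I) + Real.pi * Complex.I by push_cast; ring, Complex.exp_add,
      Complex.exp_int_mul_two_pi_mul_I, Complex.exp_pi_mul_I, one_mul]
  rw [this]
  push_cast
  field_simp
  rw [Complex.I_sq]
  ring

/-- The entry in row `i` and column `k` of a Hilbert type matrix, with the shift by a half integer
that keeps the denominator away from zero. The subtraction takes place in `ℝ`. -/
noncomputable def hilbertEntry (i k : ℕ) : ℝ := 2 / (Real.pi * (2 * ((k : ℝ) - i) + 1))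

/-- The Hilbert matrix is a contraction, in the form of Bessel's inequality for its columns. -/
theorem hilbert_bessel {n : ℕ} (w : EuclideanSpace ℂ (Fin n)) :
    ∑ k : Fin n, ‖inner ℂ w (WithLp.toLp 2 fun i : Fin n => (hilbertEntry i k : ℂ))‖ ^ 2 ≤
      ‖w‖ ^ 2 := by
  have hu : Orthonormal ℂ fun i : Fin n => expoLp (2 * (i : ℕ)) := by
    rw [orthonormal_iff_ite]
    intro i j
    split_ifs with h
    · rw [h, inner_expoLp_self]
    · exact inner_expoLp_of_even (by have := Fin.val_ne_of_ne h; omega) ⟨j - i, by ring⟩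
  have hv : Orthonormal ℂ fun i : Fin n => expoLp (2 * (i : ℕ) + 1) := by
    rw [orthonormal_iff_ite]
    intro i j
    split_ifs with h
    · rw [h, inner_expoLp_self]
    · exact inner_expoLp_of_even (by have := Fin.val_ne_of_ne h; omega) ⟨j - i, by ring⟩
  have hn : ‖∑ i, w i • expoLp (2 * (i : ℕ))‖ ^ 2 = ‖w‖ ^ 2 := by
    rw [EuclideanSpace.norm_sq_eq, ← Complex.ofReal_inj]
    push_cast
    have := inner_self_eq_norm_sq_to_K (𝕜 := ℂ) (∑ i : Fin n, w i • expoLp (2 * (i : ℕ)))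
    rw [hu.inner_sum] at this
    simp only [Complex.coe_algebraMap] at this
    rw [← this]
    exact Finset.sum_congr rfl fun i _ => Complex.conj_mul' _
  rw [← hn]
  refine le_trans (le_of_eq ?_) (hv.sum_inner_products_le (s := Finset.univ) _)
  refine Finset.sum_congr rfl fun k _ => ?_
  congr 1
  rw [norm_inner_symm (expoLp _), sum_inner]
  simp only [inner_smul_left]
  have : ∀ i : Fin n, inner ℂ (expoLp (2 * (i : ℕ))) (expoLp (2 * (k : ℕ) + 1)) =
      Complex.I * (hilbertEntry i k : ℂ) := fun i => by
    rw [inner_expoLp_of_odd ⟨k - i, by ring⟩, hilbertEntry]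
    push_cast
    congr 3
    ring
  simp only [this, mul_left_comm _ Complex.I]
  rw [← Finset.mul_sum, norm_mul, Complex.norm_I, one_mul]
  simp [PiLp.inner_apply, mul_comm]

/-! ### Harmonic sums -/

theorem mul_log_le_sum_harmonic (m : ℕ) :
    m * Real.log (m + 1) / 2 ≤ ∑ t ∈ Finset.range m, (harmonic (t + 1) : ℝ) := by
  have h : m * (harmonic m : ℝ) / 2 ≤ ∑ t ∈ Finset.range m, (harmonic (t + 1) : ℝ) := by
    induction m with
    | zero => simp
    | succ m ih =>
      rw [Finset.sum_range_succ]
      have h1 : (1 : ℝ) ≤ harmonic (m + 1) := by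
        rw [harmonic_eq_sum_Icc]
        push_cast
        have := Finset.single_le_sum (f := fun i : ℕ => ((i : ℝ))⁻¹) (s := Finset.Icc 1 (m + 1))
          (fun i _ => by positivity) (Finset.mem_Icc.2 ⟨le_refl 1, by omega⟩)
        simpa using this
      have h2 : (harmonic (m + 1) : ℝ) = harmonic m + ((m : ℝ) + 1)⁻¹ := by
        rw [harmonic_succ]; push_cast; ring
      have h3 : (m : ℝ) * ((m : ℝ) + 1)⁻¹ ≤ 1 := by
        rw [← div_eq_mul_inv, div_le_one (by positivity)]; linarith
      push_cast
      have h4 : (m : ℝ) * (harmonic (m + 1) : ℝ) = m * harmonic m + m * ((m : ℝ) + 1)⁻¹ := by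
        rw [h2]; ring
      linarith
  have h' := log_add_one_le_harmonic m
  push_cast at h'
  refine le_trans ?_ h
  gcongr

theorem harmonic_le_sum_hilbertEntry (t : ℕ) :
    (harmonic (t + 1) : ℝ) / Real.pi ≤ ∑ i ∈ Finset.range (t + 1), hilbertEntry i t := by
  -- Reversing the harmonic sum pairs `2 / (2 (t - i) + 1)` with `1 / (t - i + 1)`.
  rw [harmonic, ← Finset.sum_range_reflect]
  push_cast
  rw [Finset.sum_div]
  refine Finset.sum_le_sum fun i hi => ?_
  have hi' : i ≤ t := by simpa [Nat.lt_succ_iff] using hi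
  have : ((t - i : ℕ) : ℝ) = t - i := Nat.cast_sub hi'
  have h0 : (0 : ℝ) ≤ t - i := by
    rw [sub_nonneg]; exact_mod_cast hi'
  rw [hilbertEntry, this, inv_eq_one_div, div_div, div_le_div_iff₀ (by positivity) (by positivity)]
  nlinarith [Real.pi_pos]

/-! ### The extremal martingale -/

/-- The matrix with entries `1 / m` in the lower left `m × m` block and zero elsewhere; rows are
counted from the bottom by `Fin.rev`. It has rank one when `1 ≤ m ≤ n`. -/
noncomputable def cornerBlock (n m : ℕ) : Mat n :=
  Matrix.of fun i j => if (i.rev : ℕ) < m ∧ (j : ℕ) < m then (m : ℂ)⁻¹ else 0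

theorem cornerBlock_of_le {m : ℕ} (hm : 2 * m ≤ n) (i j : Fin n) (h : i ≤ j) :
    cornerBlock n m i j = 0 := by
  rw [cornerBlock, Matrix.of_apply, if_neg]
  rw [Fin.le_def] at h
  rw [Fin.val_rev]
  omega

theorem sum_ite_val_lt {M : Type*} [AddCommMonoid M] {m : ℕ} (hm : m ≤ n) (f : ℕ → M) :
    ∑ i : Fin n, (if (i : ℕ) < m then f i else 0) = ∑ i ∈ Finset.range m, f i := by
  rw [Fin.sum_univ_eq_sum_range (fun i => if i < m then f i else 0), ← Finset.sum_filter]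
  congr 1
  ext i
  simp only [Finset.mem_filter, Finset.mem_range]
  omega

theorem sum_ite_val_lt_const {m : ℕ} (hm : m ≤ n) (c : ℂ) :
    ∑ i : Fin n, (if (i : ℕ) < m then c else 0) = m * c := by
  rw [sum_ite_val_lt hm fun _ => c, Finset.sum_const, Finset.card_range, nsmul_eq_mul]

theorem lpNorm_one_cornerBlock {m : ℕ} (h0 : m ≠ 0) (hm : m ≤ n) :
    lpNorm 1 (cornerBlock n m) = 1 := by
  have h0' : (m : ℂ) ≠ 0 := by exact_mod_cast h0
  -- `|X|` is the projection `P` onto the normalized indicator vector of the first `m` indices.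
  set P : Mat n := Matrix.of fun i j => if (i : ℕ) < m ∧ (j : ℕ) < m then (m : ℂ)⁻¹ else 0 with hP
  have hPP : Pᴴ * P = P := by
    ext i j
    have : ∀ r : Fin n, star (P r i) * P r j =
        if (r : ℕ) < m then (if (i : ℕ) < m ∧ (j : ℕ) < m then (m : ℂ)⁻¹ * (m : ℂ)⁻¹ else 0)
          else 0 := fun r => by
      simp only [hP, Matrix.of_apply]
      split_ifs <;> first | (exfalso; tauto) | simp
    simp only [Matrix.mul_apply, Matrix.conjTranspose_apply, this, sum_ite_val_lt_const hm]
    simp only [hP, Matrix.of_apply]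
    split_ifs <;> simp [h0']
  have hXX : (cornerBlock n m)ᴴ * cornerBlock n m = P := by
    rw [← hPP]
    ext i j
    simp only [Matrix.mul_apply, Matrix.conjTranspose_apply]
    rw [← Equiv.sum_comp Fin.revPerm]
    simp only [cornerBlock, hP, Matrix.of_apply, Fin.revPerm_apply, Fin.rev_rev]
  have hPsd : 0 ≤ P := by
    rw [← hPP]
    exact (Matrix.posSemidef_conjTranspose_mul_self P).nonneg
  have hsa : Pᴴ = P := (Matrix.nonneg_iff_posSemidef.1 hPsd).isHermitian
  have habs : CFC.abs (cornerBlock n m) = P := by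
    rw [CFC.abs, Matrix.star_eq_conjTranspose, hXX]
    exact CFC.sqrt_unique (by rw [← hPP, hPP]; nth_rw 1 [← hsa]; exact hPP) hPsd
  have htr : P.trace = 1 := by
    simp only [Matrix.trace, Matrix.diag_apply, hP, Matrix.of_apply, and_self]
    rw [sum_ite_val_lt_const hm, mul_inv_cancel₀ h0']
  rw [lpNorm_one, habs, htr, Complex.one_re]

/-- The pairing reduces to the triangular part of the Hilbert matrix: `condExp k` keeps the rows
`s ≤ k` of the block, and the reversed basis vector selects a column inside the block exactly when
row `k` meets the block. -/
theorem sum_inner_cornerBlock {m : ℕ} (hm : 2 * m ≤ n) :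
    (∑ k : Fin n, inner ℂ (WithLp.toLp 2 fun i : Fin n => (hilbertEntry i k : ℂ))
      (Matrix.toEuclideanCLM (n := Fin n) (𝕜 := ℂ) (condExp k (cornerBlock n m))
        (EuclideanSpace.single k.rev 1))) =
      ((((m : ℝ)⁻¹ * ∑ t ∈ Finset.range m, ∑ i ∈ Finset.range (t + 1), hilbertEntry i t) : ℝ) :
        ℂ) := by
  have h1 : ∀ k : Fin n, inner ℂ (WithLp.toLp 2 fun i : Fin n => (hilbertEntry i k : ℂ))
      (Matrix.toEuclideanCLM (n := Fin n) (𝕜 := ℂ) (condExp k (cornerBlock n m))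
        (EuclideanSpace.single k.rev 1)) =
      ∑ s : Fin n, if s ≤ k ∧ (s.rev : ℕ) < m ∧ (k.rev : ℕ) < m then
        (m : ℂ)⁻¹ * (hilbertEntry s k : ℂ) else 0 := fun k => by
    simp only [PiLp.inner_apply, Matrix.ofLp_toEuclideanCLM, PiLp.ofLp_single,
      Matrix.mulVec_single_one, Matrix.col_apply, condExp_apply_of_lower (cornerBlock_of_le hm)]
    refine Finset.sum_congr rfl fun s _ => ?_
    simp only [cornerBlock, Matrix.of_apply, ite_and]
    split_ifs <;> simp
  -- The kernel depends on the difference of the indices only, so reversal exchanges them.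
  have h2 : ∀ s k : Fin n, hilbertEntry s.rev k.rev = hilbertEntry k s := fun s k => by
    have := s.isLt
    have := k.isLt
    rw [hilbertEntry, hilbertEntry, Fin.val_rev, Fin.val_rev, Nat.cast_sub (by omega),
      Nat.cast_sub (by omega)]
    push_cast
    congr 3
    ring
  simp only [h1]
  rw [← Equiv.sum_comp Fin.revPerm, Finset.sum_congr rfl fun k _ =>
    (Equiv.sum_comp Fin.revPerm _).symm, Finset.sum_comm]
  simp only [Fin.revPerm_apply, Fin.rev_le_rev, Fin.rev_rev, h2]
  push_cast
  rw [Finset.mul_sum]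
  have h3 : ∀ s : Fin n, (∑ k : Fin n, if k ≤ s ∧ (s : ℕ) < m ∧ (k : ℕ) < m then
      (m : ℂ)⁻¹ * (hilbertEntry k s : ℂ) else 0) =
      if (s : ℕ) < m then (m : ℂ)⁻¹ * ∑ k ∈ Finset.range (s + 1), (hilbertEntry k s : ℂ) else 0 :=
    fun s => by
    split_ifs with hs
    · rw [Finset.mul_sum, ← sum_ite_val_lt (n := n) (by omega)
        fun k => (m : ℂ)⁻¹ * (hilbertEntry k s : ℂ)]
      refine Finset.sum_congr rfl fun k _ => if_congr ?_ rfl rfl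
      rw [Fin.le_def]
      omega
    · exact Finset.sum_eq_zero fun k _ => if_neg fun h => hs h.2.1
  simp only [h3]
  exact sum_ite_val_lt (by omega)
    fun s => (m : ℂ)⁻¹ * ∑ k ∈ Finset.range (s + 1), (hilbertEntry k s : ℂ)

theorem idNorm_ge {m : ℕ} (h0 : m ≠ 0) (hm : 2 * m ≤ n) :
    ENNReal.ofReal ((m : ℝ)⁻¹ *
      ∑ t ∈ Finset.range m, ∑ i ∈ Finset.range (t + 1), hilbertEntry i t) ≤ idNorm n := by
  refine le_trans ?_ (le_iSup₂_of_le (fun k => condExp k (cornerBlock n m))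
    (isMartingale_condExp _) (le_iSup_of_le ?_ le_rfl))
  · refine le_trans ?_ (le_hardyMaxNorm _
      (fun k => WithLp.toLp 2 fun i : Fin n => (hilbertEntry i k : ℂ))
      (fun k => EuclideanSpace.single k.rev 1) hilbert_bessel ?_)
    · rw [sum_inner_cornerBlock hm, Complex.norm_real]
      exact ENNReal.ofReal_le_ofReal (le_abs_self _)
    · intro w
      rw [EuclideanSpace.norm_sq_eq, ← Equiv.sum_comp Fin.revPerm fun i => ‖w i‖ ^ 2]
      simp [EuclideanSpace.inner_single_right]
  · refine (hardyNorm_condExp_le (cornerBlock_of_le hm)).trans ?_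
    rw [lpNorm_one_cornerBlock h0 (by omega), ENNReal.ofReal_one]

end MatrixHardy

theorem lemma9 :
    ∃ c : ℝ, 0 < c ∧ ∀ n : ℕ, 1 ≤ n →
      ENNReal.ofReal (c * Real.log (n : ℝ)) ≤ MatrixHardy.idNorm n := by
  refine ⟨1 / (4 * Real.pi), by positivity, fun n hn => ?_⟩
  obtain rfl | hn2 : n = 1 ∨ 2 ≤ n := by omega
  · -- For `n = 1` the bound is trivial, and the block below would be empty.
    simp
  set m := n / 2 with hm
  have h0 : m ≠ 0 := by omega
  have hm0 : (0 : ℝ) < m := by exact_mod_cast Nat.pos_of_ne_zero h0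
  refine le_trans (ENNReal.ofReal_le_ofReal ?_) (MatrixHardy.idNorm_ge h0 (by omega))
  have hlog : Real.log n ≤ 2 * Real.log (m + 1) := by
    have h : n ≤ (m + 1) ^ 2 := by
      have : n ≤ 2 * m + 1 := by omega
      nlinarith
    rw [← Nat.cast_ofNat, ← Real.log_pow]
    exact Real.log_le_log (by positivity) (by exact_mod_cast h)
  have hsum : m * Real.log (m + 1) / 2 / Real.pi ≤
      ∑ t ∈ Finset.range m, ∑ i ∈ Finset.range (t + 1), MatrixHardy.hilbertEntry i t :=
    calc _ ≤ (∑ t ∈ Finset.range m, (harmonic (t + 1) : ℝ)) / Real.pi := by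
          gcongr
          exact MatrixHardy.mul_log_le_sum_harmonic m
      _ ≤ _ := by
          rw [Finset.sum_div]
          exact Finset.sum_le_sum fun t _ => MatrixHardy.harmonic_le_sum_hilbertEntry t
  calc 1 / (4 * Real.pi) * Real.log n ≤ 1 / (4 * Real.pi) * (2 * Real.log (m + 1)) := by gcongr
    _ = (m : ℝ)⁻¹ * (m * Real.log (m + 1) / 2 / Real.pi) := by field_simp; ring
    _ ≤ _ := by gcongr
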